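/- Let $T$ be a locally finite tree (infinite or finite, possibly with leaves) with a root vertex $o$ that is an endpoint of exactly one edge, the root edge $\omega$. For an edge $\alpha\in E(T)$ let $b(\alpha)$ and $e(\alpha)$ be its endpoints, $b(\alpha)$ being the one closer to $o$; for a vertex $x$ let $P(x)$ be the set of edges on the path from $o$ to $x$, and write $\alpha\le\beta$ if $\alpha\in P(e(\beta))$. A leaf is an edge $\alpha$ with no $\beta>\alpha$. The boundary $\partial T$ consists of the half-infinite geodesics starting at $o$ together with the leaves. For $\zeta\in\partial T$ let $P(\zeta)$ be the set of edges of the geodesic $\zeta$ (respectively, if $\zeta$ is a leaf $\alpha$, the set of edges $\beta\le\alpha$). Put $\partial T_\alpha=\{\zeta\in\partial T:\alpha\in P(\zeta)\}$; these sets form a basis of the topology of $\partial T$. Let $1<p<\infty$ and $1/p+1/p'=1$. For $f:E(T)\to[0,\infty)$ and $x\in V(T)\cup\partial T$ let $If(x)=\sum_{\alpha\in P(x)}f(\alpha)\in[0,\infty]$. For an arbitrary set $E\subseteq\partial T$ let $\Omega_E$ be the set of nonnegative $f\in\ell^p(E(T))$ with $If\ge1$ on $E$, and let $c_p(E)=\inf_{f\in\Omega_E}\|f\|_p^p$.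 For a finite positive Borel measure $\mu$ on $\partial T$ let $M(\alpha)=\mu(\partial T_\alpha)$ and $M_p(\alpha)=M(\alpha)^{p'-1}$. The measure $\mu$ is the $p$-equilibrium measure of $E$ if it is supported in $\overline E$, if $M_p$ is the $p$-equilibrium function of $E$ (that is, $M_p$ lies in the closure of $\Omega_E$ in $\ell^p$ and $\|M_p\|_p^p=c_p(E)$), and if $\mu(\overline E)=c_p(E)$. **Theorem.** Let $\mu$ be a finite positive Borel measure on $\partial T$ such that $IM_p<1$ on $V(T)$, and define, for $\alpha\in E(T)$, $$c(\alpha)=\frac{M(\alpha)}{\bigl(1-IM_p(b(\alpha))\bigr)^{p/p'}}.$$ Then $\mu$ is the $p$-equilibrium measure of some set $E\subseteq\partial T$ if and only if, for every $\alpha\in E(T)$, $$c(\alpha)\bigl(1-c(\alpha)^{p'-1}\bigr)=\sum_{\beta>\alpha}c(\beta)^{p'}\prod_{\alpha\le\gamma<\beta}\bigl(1-c(\gamma)^{p'-1}\bigr)^p ,$$ where the equality includes the convergence of the series on the right. -/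

import Mathlib

open scoped NNReal ENNReal

/-- A rooted tree: a connected, acyclic, locally finite graph with a root vertex `root` that is an
endpoint of one and only one edge (the root edge). Leaves are allowed. -/
structure RootEdgeTree (V : Type*) where
  graph : SimpleGraph V
  root : V
  isTree : graph.IsTree
  locallyFinite : ∀ x, (graph.neighborSet x).Finite
  root_unique_neighbor : ∃! x, graph.Adj root x

namespace RootEdgeTree

variable {V : Type*} (T : RootEdgeTree V)

/-- The edges of the tree. Each edge is recorded with its endpoints in the order `b`, `e`, where
`b` is the endpoint closest to the root. -/
@[ext]
structure Edge where
  /-- the beginning vertex -/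
  b : V
  /-- the ending vertex -/
  e : V
  adj : T.graph.Adj b e
  dist_eq : T.graph.dist T.root e = T.graph.dist T.root b + 1

/-- The predecessor set `P(x)` of a vertex `x`: the edges on the path from the root to `x`. -/
def predV (x : V) : Set T.Edge :=
  {α | ∃ w : T.graph.Walk T.root x, w.IsPath ∧ s(α.b, α.e) ∈ w.edges}

/-- `α ≤ β`: the path from the root that ends by crossing `β` crosses `α`. -/
def le (α β : T.Edge) : Prop := α ∈ T.predV β.e

/-- `α < β`. -/
def lt (α β : T.Edge) : Prop := T.le α β ∧ α ≠ β

/-- The edge `α` is a leaf: no edge lies strictly beyond it. -/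
def IsLeaf (α : T.Edge) : Prop := ∀ β, ¬ T.lt α β

/-- The boundary of the tree: the half-infinite geodesics starting at the root, together with
the leaves. -/
inductive Boundary where
  | ray (ζ : ℕ → V) (zero : ζ 0 = T.root) (adj : ∀ n, T.graph.Adj (ζ n) (ζ (n + 1)))
      (inj : Function.Injective ζ) : Boundary
  | leaf (α : T.Edge) (isLeaf : T.IsLeaf α) : Boundary

/-- The predecessor set `P(ζ)` of a boundary point. -/
def predB : T.Boundary → Set T.Edge
  | .ray ζ _ _ _ => {α | ∃ n, α.b = ζ n ∧ α.e = ζ (n + 1)}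
  | .leaf β _ => {α | T.le α β}

/-- The boundary `∂T_α` of the tent rooted in `α`, as a subset of `∂T`. -/
def tentBoundary (α : T.Edge) : Set T.Boundary := {ζ | α ∈ T.predB ζ}

/-- The topology on `∂T` generated by the sets `∂T_α`. -/
instance : TopologicalSpace T.Boundary :=
  TopologicalSpace.generateFrom (Set.range T.tentBoundary)

instance : MeasurableSpace T.Boundary := borel _

instance : BorelSpace T.Boundary := ⟨rfl⟩

/-- The potential `If(x)` at a vertex `x`. -/
noncomputable def potentialV (f : T.Edge → ℝ≥0) (x : V) : ℝ≥0∞ :=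
  ∑' α : T.predV x, (f α : ℝ≥0∞)

/-- The potential `If(ζ)` at a boundary point `ζ`. -/
noncomputable def potentialB (f : T.Edge → ℝ≥0) (ζ : T.Boundary) : ℝ≥0∞ :=
  ∑' α : T.predB ζ, (f α : ℝ≥0∞)

/-- `‖f‖_p ^ p` in `ℓ^p(E(T))`, for nonnegative `f`. -/
noncomputable def normPow (p : ℝ) (f : T.Edge → ℝ≥0) : ℝ≥0∞ :=
  ∑' α, (f α : ℝ≥0∞) ^ p

/-- The class `Ω_E` of the `f ∈ ℓ^p_+` with `If ≥ 1` on `E`. -/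
def Omega (p : ℝ) (E : Set T.Boundary) : Set (T.Edge → ℝ≥0) :=
  {f | T.normPow p f < ∞ ∧ ∀ ζ ∈ E, 1 ≤ T.potentialB f ζ}

/-- The `p`-capacity of a subset of `∂T`. -/
noncomputable def capacity (p : ℝ) (E : Set T.Boundary) : ℝ≥0∞ :=
  ⨅ f ∈ T.Omega p E, T.normPow p f

/-- The closure of `Ω_E` in `ℓ^p`: the edge functions (automatically in `ℓ^p_+`) whose `ℓ^p`
distance to members of `Ω_E` can be made arbitrarily small. -/
def OmegaClosure (p : ℝ) (E : Set T.Boundary) : Set (T.Edge → ℝ≥0) :=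
  {f | ∀ ε : ℝ≥0∞, 0 < ε → ∃ g ∈ T.Omega p E, T.normPow p (fun α => nndist (f α) (g α)) < ε}

/-- `f` is the `p`-equilibrium function of `E`: the element of the `ℓ^p`-closure of `Ω_E` for which
`‖f‖_p ^ p = c_p(E)`. -/
def IsEquilibriumFunction (p : ℝ) (E : Set T.Boundary) (f : T.Edge → ℝ≥0) : Prop :=
  f ∈ T.OmegaClosure p E ∧ T.normPow p f = T.capacity p E

/-- The co-potential `M(α) = μ(∂T_α)`. -/
noncomputable def coPotential (μ : MeasureTheory.FiniteMeasure T.Boundary) (α : T.Edge) : ℝ≥0 :=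
  μ (T.tentBoundary α)

/-- The edge function `M_p = M ^ (p' - 1)`. -/
noncomputable def coPotentialPow (p' : ℝ) (μ : MeasureTheory.FiniteMeasure T.Boundary)
    (α : T.Edge) : ℝ≥0 :=
  T.coPotential μ α ^ (p' - 1)

/-- `μ` is the `p`-equilibrium measure of `E`: it is carried by the closure of `E`, `M_p` is the
`p`-equilibrium function of `E`, and `μ(closure E) = c_p(E) = ‖M_p‖_p ^ p` (the second equality is
part of `IsEquilibriumFunction`). -/
def IsEquilibriumMeasure (p p' : ℝ) (E : Set T.Boundary)
    (μ : MeasureTheory.FiniteMeasure T.Boundary) : Prop :=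
  (μ : MeasureTheory.Measure T.Boundary) (closure E)ᶜ = 0 ∧
  T.IsEquilibriumFunction p E (T.coPotentialPow p' μ) ∧
  (μ : MeasureTheory.Measure T.Boundary) (closure E) = T.capacity p E

/-- The rescaled co-potential `c(α) = M(α) / (1 - IM_p(b(α))) ^ (p / p')`. -/
noncomputable def rescaled (p p' : ℝ) (μ : MeasureTheory.FiniteMeasure T.Boundary)
    (α : T.Edge) : ℝ :=
  (T.coPotential μ α : ℝ) /
    (1 - (T.potentialV (T.coPotentialPow p' μ) α.b).toReal) ^ (p / p')

/-- The predecessor set of a vertex is finite. -/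
theorem predV_finite (x : V) : (T.predV x).Finite := by
  classical
  obtain ⟨w, hw, huniq⟩ := T.isTree.existsUnique_path T.root x
  have hfin : (((fun α : T.Edge => (α.b, α.e)) '' T.predV x)).Finite := by
    refine Set.Finite.subset (s := {q : V × V | q.1 ∈ w.support ∧ q.2 ∈ w.support}) ?_ ?_
    · exact (w.support.finite_toSet).prod (w.support.finite_toSet)
    · rintro q ⟨α, ⟨w', hw', hα⟩, rfl⟩
      obtain rfl := huniq w' hw'
      exact ⟨w'.fst_mem_support_of_mem_edges hα, w'.snd_mem_support_of_mem_edges hα⟩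
  refine Set.Finite.of_finite_image hfin ?_
  intro α _ β _ h
  simp only [Prod.mk.injEq] at h
  exact Edge.ext h.1 h.2

/-- The edges `γ` with `α ≤ γ < β`. -/
def Ico (α β : T.Edge) : Set T.Edge := {γ | T.le α γ ∧ T.lt γ β}

theorem Ico_finite (α β : T.Edge) : (T.Ico α β).Finite :=
  (T.predV_finite β.e).subset fun _ h => h.2.1

end RootEdgeTree

/-!
The energy `‖M_p‖_p ^ p = ∑ M ^ p'` is, by Tonelli, the integral of the potential `IM_p` against
`μ`. Young's inequality bounds every capacity `c_p(E)` with `E` of full measure from below by the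
mass of `μ` as soon as the energy does not exceed the mass. Since `IM_p ≤ 1` on `∂T`, it follows
that `μ` is an equilibrium measure exactly when its energy equals its mass, that is, when `IM_p = 1`
almost everywhere. Integrating `IM_p` over the tent of `α` localizes this condition to
`∑_{β > α} M(β) ^ p' = M(α) (1 - IM_p(e(α)))`. Finally
`1 - c(γ) ^ (p' - 1) = (1 - IM_p(e(γ))) / (1 - IM_p(b(γ)))`, so the products in the theorem
telescope and its equation is the localized identity divided by `(1 - IM_p(b(α))) ^ p`.
-/

section Graph

variable {V : Type*} {G : SimpleGraph V}

theorem exists_adj_dist_eq_dist_add_one (hG : G.Connected) {x y : V} (hxy : x ≠ y) :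
    ∃ z, G.Adj z y ∧ G.dist x y = G.dist x z + 1 := by
  obtain ⟨w, hw⟩ := hG.exists_walk_length_eq_dist x y
  have hnil : ¬ w.Nil := fun h => hxy h.eq
  have hadj := w.adj_penultimate hnil
  have hle : G.dist x w.penultimate ≤ w.length - 1 := by
    simpa using SimpleGraph.dist_le w.dropLast
  have htri := hG.dist_triangle (u := x) (v := w.penultimate) (w := y)
  rw [SimpleGraph.dist_eq_one_iff_adj.2 hadj] at htri
  have hpos := hG.pos_dist_of_ne hxy
  exact ⟨w.penultimate, hadj, by omega⟩

theorem finite_setOf_dist_le (hG : G.Connected) (hfin : ∀ x, (G.neighborSet x).Finite) (x : V)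
    (n : ℕ) : {y | G.dist x y ≤ n}.Finite := by
  induction n with
  | zero => exact (Set.finite_singleton x).subset fun y hy =>
      (hG.dist_eq_zero_iff.1 (Nat.le_zero.1 hy)).symm
  | succ n ih =>
    refine ((ih.biUnion fun z _ => hfin z).insert x).subset fun y hy => ?_
    rcases eq_or_ne x y with rfl | hxy
    · exact Set.mem_insert _ _
    · obtain ⟨z, hzy, hz⟩ := exists_adj_dist_eq_dist_add_one hG hxy
      have hzn : G.dist x z ≤ n := Nat.le_of_succ_le_succ (hz.symm.trans_le hy)
      exact Or.inr (Set.mem_biUnion hzn hzy)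

theorem countable_of_connected_of_finite_neighborSet (hG : G.Connected)
    (hfin : ∀ x, (G.neighborSet x).Finite) : Countable V := by
  obtain ⟨x⟩ := hG.nonempty
  refine Set.countable_univ_iff.1 ((Set.countable_iUnion fun n =>
    (finite_setOf_dist_le hG hfin x n).countable).mono fun y _ => ?_)
  exact Set.mem_iUnion.2 ⟨_, le_refl (G.dist x y)⟩

theorem length_eq_dist_of_isPath (hG : G.IsTree) {x y : V} {w : G.Walk x y} (hw : w.IsPath) :
    w.length = G.dist x y := by
  obtain ⟨w', hw', hlen⟩ := hG.connected.exists_path_of_dist x y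
  rw [(hG.existsUnique_path x y).unique hw hw', hlen]

theorem dist_le_dist_of_mem_support_of_isPath (hG : G.IsTree) {x y z : V} {w : G.Walk x y}
    (hw : w.IsPath) (hz : z ∈ w.support) : G.dist x z ≤ G.dist x y := by
  classical
  rw [← length_eq_dist_of_isPath hG hw]
  exact (SimpleGraph.dist_le (w.takeUntil z hz)).trans (w.length_takeUntil_le_length hz)

end Graph

section ENNReal

theorem tsum_iUnion_of_directed {ι α : Type*} [Nonempty ι] (f : α → ℝ≥0∞) {s : ι → Set α}
    (hs : Directed (· ⊆ ·) s) : ∑' a : ⋃ i, s i, f a = ⨆ i, ∑' a : s i, f a := by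
  refine le_antisymm ?_ (iSup_le fun i => ENNReal.tsum_mono_subtype f (Set.subset_iUnion s i))
  rw [ENNReal.tsum_eq_iSup_sum]
  refine iSup_le fun t => ?_
  set u : Finset α := t.map (Function.Embedding.subtype _)
  obtain ⟨i, hi⟩ : ∃ i, (u : Set α) ⊆ s i :=
    hs.exists_mem_subset_of_finset_subset_biUnion fun a ha => by
      obtain ⟨b, -, rfl⟩ := Finset.mem_map.1 (Finset.mem_coe.1 ha)
      exact b.2
  calc ∑ a ∈ t, f a = ∑' a : (u : Set α), f a := by
        rw [Finset.tsum_subtype', Finset.sum_map]; rfl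
    _ ≤ ∑' a : s i, f a := ENNReal.tsum_mono_subtype f hi
    _ ≤ ⨆ i, ∑' a : s i, f a := le_iSup (fun i => ∑' a : s i, f a) i

theorem hasSum_coe_toReal_iff_tsum_eq {ι : Type*} {f : ι → ℝ≥0} {a : ℝ≥0∞} (ha : a ≠ ∞) :
    HasSum (fun i => (f i : ℝ)) a.toReal ↔ ∑' i, (f i : ℝ≥0∞) = a := by
  lift a to ℝ≥0 using ha
  rw [ENNReal.coe_toReal, NNReal.hasSum_coe, ← ENNReal.hasSum_coe, ENNReal.summable.hasSum_iff]

theorem ae_eq_iff_lintegral_eq {Ω : Type*} [MeasurableSpace Ω] {μ : MeasureTheory.Measure Ω}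
    {f g : Ω → ℝ≥0∞} (hfg : f ≤ᵐ[μ] g) (hg : AEMeasurable g μ) (hfin : ∫⁻ x, g x ∂μ ≠ ∞) :
    f =ᵐ[μ] g ↔ ∫⁻ x, f x ∂μ = ∫⁻ x, g x ∂μ :=
  ⟨MeasureTheory.lintegral_congr_ae, fun h =>
    MeasureTheory.ae_eq_of_ae_le_of_lintegral_le hfg (h ▸ hfin) hg h.ge⟩

end ENNReal

namespace RootEdgeTree

section Order

variable {V : Type*} {T : RootEdgeTree V}

theorem exists_edge_of_adj {x y : V} (h : T.graph.Adj x y) :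
    ∃ α : T.Edge, α.b = x ∧ α.e = y ∨ α.b = y ∧ α.e = x := by
  rcases T.isTree.dist_eq_dist_add_one_of_adj T.root h with hd | hd
  · exact ⟨⟨y, x, h.symm, hd⟩, Or.inr ⟨rfl, rfl⟩⟩
  · exact ⟨⟨x, y, h, hd⟩, Or.inl ⟨rfl, rfl⟩⟩

theorem Edge.e_ne_root (α : T.Edge) : α.e ≠ T.root := fun h => by
  have hd := α.dist_eq
  rw [h, SimpleGraph.dist_self] at hd
  omega

theorem Edge.eq_of_sym2_eq {α β : T.Edge} (h : s(α.b, α.e) = s(β.b, β.e)) : α = β := by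
  rcases Sym2.eq_iff.1 h with ⟨hb, he⟩ | ⟨hb, he⟩
  · exact Edge.ext hb he
  · have hα := α.dist_eq
    have hβ := β.dist_eq
    rw [hb, he] at hα
    omega

theorem vertex_induction (T : RootEdgeTree V) {P : V → Prop} (root : P T.root)
    (step : ∀ α : T.Edge, P α.b → P α.e) (x : V) : P x := by
  induction h : T.graph.dist T.root x generalizing x with
  | zero => exact T.isTree.connected.dist_eq_zero_iff.1 h ▸ root
  | succ n ih =>
    have hne : T.root ≠ x := by
      rintro rfl
      rw [SimpleGraph.dist_self] at h
      omega
    obtain ⟨y, hyx, hy⟩ := exists_adj_dist_eq_dist_add_one T.isTree.connected hne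
    exact step ⟨y, x, hyx, hy⟩ (ih y (by omega))

theorem dist_e_le_of_mem_predV {x : V} {γ : T.Edge} (h : γ ∈ T.predV x) :
    T.graph.dist T.root γ.e ≤ T.graph.dist T.root x := by
  obtain ⟨w, hw, hγ⟩ := h
  exact dist_le_dist_of_mem_support_of_isPath T.isTree hw (w.snd_mem_support_of_mem_edges hγ)

theorem notMem_predV_b (α : T.Edge) : α ∉ T.predV α.b := fun h => by
  have hle := dist_e_le_of_mem_predV h
  have hd := α.dist_eq
  omega

theorem predV_root : T.predV T.root = ∅ := by
  refine Set.eq_empty_of_forall_notMem fun γ hγ => ?_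
  have hle := dist_e_le_of_mem_predV hγ
  have hd := γ.dist_eq
  rw [SimpleGraph.dist_self] at hle
  omega

theorem predV_e (α : T.Edge) : T.predV α.e = insert α (T.predV α.b) := by
  obtain ⟨w, hw, huniq⟩ := T.isTree.existsUnique_path T.root α.b
  have he : α.e ∉ w.support := fun h => by
    have hle := dist_le_dist_of_mem_support_of_isPath T.isTree hw h
    have hd := α.dist_eq
    omega
  have hpath : (w.concat α.adj).IsPath := hw.concat he α.adj
  ext γ
  simp only [predV, Set.mem_insert_iff, Set.mem_ofPred_eq]
  constructor
  · rintro ⟨w', hw', hγ⟩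
    obtain rfl := (T.isTree.existsUnique_path T.root α.e).unique hw' hpath
    rw [SimpleGraph.Walk.edges_concat, List.concat_eq_append, List.mem_append,
      List.mem_singleton] at hγ
    exact hγ.symm.imp Edge.eq_of_sym2_eq fun hγ => ⟨w, hw, hγ⟩
  · rintro (rfl | ⟨w', hw', hγ⟩)
    · exact ⟨_, hpath, by simp [SimpleGraph.Walk.edges_concat]⟩
    · obtain rfl := huniq w' hw'
      exact ⟨_, hpath, by simp [SimpleGraph.Walk.edges_concat, hγ]⟩

theorem toFinset_predV_e [DecidableEq T.Edge] (α : T.Edge) :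
    (T.predV_finite α.e).toFinset = insert α (T.predV_finite α.b).toFinset := by
  ext γ
  simp only [Set.Finite.mem_toFinset, Finset.mem_insert, predV_e, Set.mem_insert_iff]

theorem mem_predV_of_le {x : V} {β γ : T.Edge} (hγ : T.le γ β) (hβ : β ∈ T.predV x) :
    γ ∈ T.predV x := by
  induction x using T.vertex_induction with
  | root => exact absurd hβ (predV_root ▸ Set.notMem_empty β)
  | step α ih =>
    rw [predV_e] at hβ ⊢
    rcases hβ with rfl | hβ
    · rwa [le, predV_e] at hγ
    · exact Or.inr (ih hβ)

theorem le_total_of_mem_predV {x : V} {α β : T.Edge} (hα : α ∈ T.predV x) (hβ : β ∈ T.predV x) :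
    T.le α β ∨ T.le β α := by
  induction x using T.vertex_induction with
  | root => exact absurd hβ (predV_root ▸ Set.notMem_empty β)
  | step δ ih =>
    by_cases hαδ : α = δ
    · exact Or.inr (hαδ ▸ hβ)
    by_cases hβδ : β = δ
    · exact Or.inl (hβδ ▸ hα)
    rw [predV_e] at hα hβ
    exact ih (hα.resolve_left hαδ) (hβ.resolve_left hβδ)

theorem lt_iff_mem_predV_b {α β : T.Edge} : T.lt α β ↔ α ∈ T.predV β.b := by
  rw [lt, le, predV_e]
  constructor
  · rintro ⟨h, hne⟩
    exact h.resolve_left hne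
  · intro h
    exact ⟨Or.inr h, by rintro rfl; exact notMem_predV_b _ h⟩

theorem le.refl (α : T.Edge) : T.le α α := by
  rw [le, predV_e]
  exact Set.mem_insert _ _

theorem le.trans {α β γ : T.Edge} (h : T.le α β) (h' : T.le β γ) : T.le α γ :=
  mem_predV_of_le h h'

theorem le.antisymm {α β : T.Edge} (h : T.le α β) (h' : T.le β α) : α = β := by
  by_contra hne
  have hαβ := dist_e_le_of_mem_predV (lt_iff_mem_predV_b.1 ⟨h, hne⟩)
  have hβα := dist_e_le_of_mem_predV h'
  have hd := β.dist_eq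
  omega

theorem Edge.e_injective : Function.Injective (Edge.e : T.Edge → V) := fun α β h =>
  le.antisymm (h ▸ le.refl α : α ∈ T.predV β.e) (h ▸ le.refl β : β ∈ T.predV α.e)

instance : Countable T.Edge :=
  have := countable_of_connected_of_finite_neighborSet T.isTree.connected T.locallyFinite
  Edge.e_injective.countable

theorem predV_b_union_Ico {α β : T.Edge} (h : T.le α β) :
    T.predV α.b ∪ T.Ico α β = T.predV β.b := by
  ext γ
  simp only [Ico, Set.mem_union, Set.mem_ofPred_eq, ← lt_iff_mem_predV_b]
  constructor
  · rintro (hγ | hγ)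
    · exact ⟨hγ.1.trans h, fun hγβ => hγ.2 (hγ.1.antisymm (hγβ ▸ h))⟩
    · exact hγ.2
  · intro hγ
    by_cases hαγ : T.le α γ
    · exact Or.inr ⟨hαγ, hγ⟩
    · have hγα := (le_total_of_mem_predV h hγ.1).resolve_left hαγ
      exact Or.inl ⟨hγα, fun heq => hαγ (heq ▸ le.refl γ)⟩

theorem disjoint_predV_b_Ico (α β : T.Edge) : Disjoint (T.predV α.b) (T.Ico α β) :=
  Set.disjoint_left.2 fun _ hγ hγ' =>
    have hγα := lt_iff_mem_predV_b.2 hγ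
    hγα.2 (hγα.1.antisymm hγ'.1)

theorem toFinset_predV_b_disjUnion_toFinset_Ico {α β : T.Edge} (h : T.le α β) :
    (T.predV_finite α.b).toFinset.disjUnion (T.Ico_finite α β).toFinset
      (Set.Finite.disjoint_toFinset.2 (disjoint_predV_b_Ico α β)) =
      (T.predV_finite β.b).toFinset := by
  ext γ
  simp only [Finset.mem_disjUnion, Set.Finite.mem_toFinset, ← predV_b_union_Ico h, Set.mem_union]

theorem exists_rootEdge (T : RootEdgeTree V) : ∃ ω : T.Edge, ∀ β, T.le ω β := by
  obtain ⟨x, hx, huniq⟩ := T.root_unique_neighbor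
  let ω : T.Edge := ⟨T.root, x, hx, by
    rw [SimpleGraph.dist_self, SimpleGraph.dist_eq_one_iff_adj.2 hx]⟩
  have hω : ∀ y, y = T.root ∨ ω ∈ T.predV y := fun y => by
    induction y using T.vertex_induction with
    | root => exact Or.inl rfl
    | step α ih =>
      rw [predV_e]
      refine Or.inr (ih.imp (fun hroot => Edge.ext hroot.symm ?_) id)
      exact (huniq _ (hroot ▸ α.adj)).symm
  exact ⟨ω, fun β => (hω β.e).resolve_left β.e_ne_root⟩

end Order

section Boundary

variable {V : Type*} {T : RootEdgeTree V}

/-- The geodesic never turns back: an edge towards the root would have to retrace the previous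
edge. -/
theorem exists_edge_of_ray {ζ : ℕ → V} (zero : ζ 0 = T.root)
    (adj : ∀ n, T.graph.Adj (ζ n) (ζ (n + 1))) (inj : Function.Injective ζ) (n : ℕ) :
    ∃ α : T.Edge, α.b = ζ n ∧ α.e = ζ (n + 1) := by
  induction n with
  | zero =>
    obtain ⟨α, hα | hα⟩ := T.exists_edge_of_adj (adj 0)
    · exact ⟨α, hα⟩
    · exact absurd (hα.2.trans zero) α.e_ne_root
  | succ n ih =>
    obtain ⟨α, hαb, hαe⟩ := ih
    obtain ⟨β, hβ | ⟨hβb, hβe⟩⟩ := T.exists_edge_of_adj (adj (n + 1))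
    · exact ⟨β, hβ⟩
    · have hαβ : α = β := Edge.e_injective (hαe.trans hβe.symm)
      have hturn : ζ n = ζ (n + 1 + 1) := by rw [← hαb, hαβ, hβb]
      have := inj hturn
      omega

theorem monotone_predV_e_of_chain {ε : ℕ → T.Edge} (hε : ∀ n, (ε (n + 1)).b = (ε n).e) :
    Monotone fun n => T.predV (ε n).e :=
  monotone_nat_of_le_succ fun n => by
    rw [predV_e (ε (n + 1)), hε]
    exact Set.subset_insert _ _

theorem iUnion_predV_e_of_chain {ε : ℕ → T.Edge} (h0 : (ε 0).b = T.root)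
    (hε : ∀ n, (ε (n + 1)).b = (ε n).e) : ⋃ n, T.predV (ε n).e = Set.range ε := by
  refine Set.Subset.antisymm (Set.iUnion_subset fun n => ?_) ?_
  · induction n with
    | zero =>
      rw [predV_e, h0, predV_root]
      exact Set.insert_subset (Set.mem_range_self 0) (Set.empty_subset _)
    | succ n ih =>
      rw [predV_e, hε]
      exact Set.insert_subset (Set.mem_range_self (n + 1)) ih
  · rintro _ ⟨n, rfl⟩
    exact Set.mem_iUnion.2 ⟨n, le.refl (ε n)⟩

theorem exists_monotone_predV_predB_eq_iUnion (ζ : T.Boundary) :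
    ∃ ε : ℕ → T.Edge, Monotone (fun n => T.predV (ε n).e) ∧
      T.predB ζ = ⋃ n, T.predV (ε n).e := by
  cases ζ with
  | leaf α hα => exact ⟨fun _ => α, monotone_const, by rw [Set.iUnion_const]; rfl⟩
  | ray ζ zero adj inj =>
    choose ε hb he using exists_edge_of_ray zero adj inj
    have hε : ∀ n, (ε (n + 1)).b = (ε n).e := fun n => (hb _).trans (he n).symm
    refine ⟨ε, monotone_predV_e_of_chain hε, ?_⟩
    rw [iUnion_predV_e_of_chain ((hb 0).trans zero) hε]
    ext α
    refine exists_congr fun n => ?_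
    rw [← hb n, ← he n, eq_comm (a := ε n), Edge.ext_iff]

theorem mem_predB_of_le {ζ : T.Boundary} {α β : T.Edge} (h : T.le α β) (hβ : β ∈ T.predB ζ) :
    α ∈ T.predB ζ := by
  obtain ⟨ε, -, hε⟩ := exists_monotone_predV_predB_eq_iUnion ζ
  rw [hε, Set.mem_iUnion] at hβ ⊢
  exact hβ.imp fun n hn => mem_predV_of_le h hn

theorem le_total_of_mem_predB {ζ : T.Boundary} {α β : T.Edge} (hα : α ∈ T.predB ζ)
    (hβ : β ∈ T.predB ζ) : T.le α β ∨ T.le β α := by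
  obtain ⟨ε, hmono, hε⟩ := exists_monotone_predV_predB_eq_iUnion ζ
  rw [hε, Set.mem_iUnion] at hα hβ
  obtain ⟨m, hm⟩ := hα
  obtain ⟨n, hn⟩ := hβ
  exact le_total_of_mem_predV (hmono (le_max_left m n) hm) (hmono (le_max_right m n) hn)

theorem tentBoundary_subset {α β : T.Edge} (h : T.le α β) :
    T.tentBoundary β ⊆ T.tentBoundary α :=
  fun _ hζ => mem_predB_of_le h hζ

theorem disjoint_tentBoundary {α β : T.Edge} (h : ¬ T.le α β) (h' : ¬ T.le β α) :
    Disjoint (T.tentBoundary α) (T.tentBoundary β) :=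
  Set.disjoint_left.2 fun _ hα hβ => (le_total_of_mem_predB hα hβ).elim h h'

theorem tentBoundary_eq_univ {ω : T.Edge} (hω : ∀ β, T.le ω β) :
    T.tentBoundary ω = Set.univ := by
  refine Set.eq_univ_of_forall fun ζ => ?_
  obtain ⟨ε, -, hε⟩ := exists_monotone_predV_predB_eq_iUnion ζ
  change ω ∈ T.predB ζ
  rw [hε]
  exact Set.mem_iUnion.2 ⟨0, hω _⟩

theorem measurableSet_tentBoundary (α : T.Edge) : MeasurableSet (T.tentBoundary α) :=
  (TopologicalSpace.isOpen_generateFrom_of_mem (Set.mem_range_self α)).measurableSet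

end Boundary

section Potential

open MeasureTheory

variable {V : Type*} {T : RootEdgeTree V}

theorem potentialV_root (f : T.Edge → ℝ≥0) : T.potentialV f T.root = 0 := by
  rw [potentialV, predV_root, tsum_empty]

theorem potentialV_e (f : T.Edge → ℝ≥0) (α : T.Edge) :
    T.potentialV f α.e = f α + T.potentialV f α.b := by
  rw [potentialV, potentialV, predV_e, Set.insert_eq,
    ENNReal.summable.tsum_union_disjoint (f := fun α : T.Edge => (f α : ℝ≥0∞))
      (Set.disjoint_singleton_left.2 (notMem_predV_b α)) ENNReal.summable,
    tsum_singleton α (fun α : T.Edge => (f α : ℝ≥0∞))]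

theorem potentialV_ne_top (f : T.Edge → ℝ≥0) (x : V) : T.potentialV f x ≠ ∞ := by
  induction x using T.vertex_induction with
  | root => simp only [potentialV_root, ne_eq, ENNReal.zero_ne_top, not_false_eq_true]
  | step α ih => exact potentialV_e f α ▸ ENNReal.add_ne_top.2 ⟨ENNReal.coe_ne_top, ih⟩

theorem potentialB_le_of_potentialV_le {f : T.Edge → ℝ≥0} {C : ℝ≥0∞}
    (h : ∀ x, T.potentialV f x ≤ C) (ζ : T.Boundary) : T.potentialB f ζ ≤ C := by
  obtain ⟨ε, hmono, hε⟩ := exists_monotone_predV_predB_eq_iUnion ζ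
  rw [potentialB, hε,
    tsum_iUnion_of_directed (fun α : T.Edge => (f α : ℝ≥0∞)) hmono.directed_le]
  exact iSup_le fun n => h (ε n).e

theorem potentialB_eq_tsum_indicator (f : T.Edge → ℝ≥0) (ζ : T.Boundary) :
    T.potentialB f ζ = ∑' β, (T.tentBoundary β).indicator (fun _ => (f β : ℝ≥0∞)) ζ :=
  tsum_subtype (T.predB ζ) fun β => (f β : ℝ≥0∞)

theorem lintegral_potentialB (f : T.Edge → ℝ≥0) (μ : Measure T.Boundary) :
    ∫⁻ ζ, T.potentialB f ζ ∂μ = ∑' β, f β * μ (T.tentBoundary β) := by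
  simp only [potentialB_eq_tsum_indicator]
  rw [lintegral_tsum fun β =>
    (measurable_const.indicator (measurableSet_tentBoundary β)).aemeasurable]
  exact tsum_congr fun β => lintegral_indicator_const (measurableSet_tentBoundary β) _

theorem setLIntegral_tentBoundary_potentialB (f : T.Edge → ℝ≥0) (μ : Measure T.Boundary)
    (α : T.Edge) :
    ∫⁻ ζ in T.tentBoundary α, T.potentialB f ζ ∂μ =
      μ (T.tentBoundary α) * T.potentialV f α.e +
        ∑' β : {β // T.lt α β}, f β * μ (T.tentBoundary β) := by
  have hbeyond : (∑' β : {β // T.lt α β}, f β * μ (T.tentBoundary β)) =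
      ∑' β, {β | T.lt α β}.indicator (fun β => f β * μ (T.tentBoundary β)) β :=
    tsum_subtype {β | T.lt α β} fun β => f β * μ (T.tentBoundary β)
  rw [lintegral_potentialB, potentialV, ← ENNReal.tsum_mul_left,
    tsum_subtype (T.predV α.e) fun β => μ (T.tentBoundary α) * (f β : ℝ≥0∞), hbeyond,
    ← ENNReal.tsum_add]
  refine tsum_congr fun β => ?_
  rw [Measure.restrict_apply (measurableSet_tentBoundary β)]
  by_cases hβα : β ∈ T.predV α.e
  · have hαβ : β ∉ {β | T.lt α β} := fun h => h.2 (h.1.antisymm hβα)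
    rw [Set.indicator_of_mem hβα, Set.indicator_of_notMem hαβ, add_zero,
      Set.inter_eq_right.2 (tentBoundary_subset hβα), mul_comm]
  rw [Set.indicator_of_notMem hβα, zero_add]
  by_cases hαβ : β ∈ {β | T.lt α β}
  · rw [Set.indicator_of_mem hαβ, Set.inter_eq_left.2 (tentBoundary_subset hαβ.1)]
  · have hle : ¬ T.le α β := fun h => hαβ ⟨h, fun heq => hβα (heq ▸ le.refl α)⟩
    rw [Set.indicator_of_notMem hαβ, (disjoint_tentBoundary hβα hle).inter_eq, measure_empty,
      mul_zero]

end Potential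

section Energy

open MeasureTheory

variable {V : Type*} {T : RootEdgeTree V}

/-- The `p`-energy `∑ M ^ p'` of a measure on the boundary, equal to both `‖M_p‖_p ^ p` and
`∫ IM_p dμ`. -/
noncomputable def energy (p' : ℝ) (μ : FiniteMeasure T.Boundary) : ℝ≥0∞ :=
  ∑' α, ((T.coPotential μ α ^ p' : ℝ≥0) : ℝ≥0∞)

/-- The part of the `p`-energy carried by the edges strictly beyond `α`. -/
noncomputable def energyBeyond (p' : ℝ) (μ : FiniteMeasure T.Boundary) (α : T.Edge) : ℝ≥0∞ :=
  ∑' β : {β // T.lt α β}, ((T.coPotential μ β ^ p' : ℝ≥0) : ℝ≥0∞)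

theorem coe_coPotential (μ : FiniteMeasure T.Boundary) (α : T.Edge) :
    (T.coPotential μ α : ℝ≥0∞) = (μ : Measure T.Boundary) (T.tentBoundary α) :=
  FiniteMeasure.ennreal_coeFn_eq_coeFn_toMeasure μ _

theorem coPotentialPow_mul_coPotential {p' : ℝ} (hp' : p' ≠ 0) (μ : FiniteMeasure T.Boundary)
    (α : T.Edge) : T.coPotentialPow p' μ α * T.coPotential μ α = T.coPotential μ α ^ p' := by
  rw [coPotentialPow, ← NNReal.rpow_add_one' (by simpa only [sub_add_cancel] using hp'),
    sub_add_cancel]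

theorem coPotentialPow_mul_measure_tentBoundary {p' : ℝ} (hp' : p' ≠ 0)
    (μ : FiniteMeasure T.Boundary) (α : T.Edge) :
    (T.coPotentialPow p' μ α : ℝ≥0∞) * (μ : Measure T.Boundary) (T.tentBoundary α) =
      ((T.coPotential μ α ^ p' : ℝ≥0) : ℝ≥0∞) := by
  rw [← coe_coPotential, ← ENNReal.coe_mul, coPotentialPow_mul_coPotential hp']

theorem lintegral_potentialB_coPotentialPow {p' : ℝ} (hp' : p' ≠ 0)
    (μ : FiniteMeasure T.Boundary) :
    ∫⁻ ζ, T.potentialB (T.coPotentialPow p' μ) ζ ∂(μ : Measure T.Boundary) = energy p' μ := by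
  simp only [lintegral_potentialB, coPotentialPow_mul_measure_tentBoundary hp', energy]

theorem setLIntegral_tentBoundary_potentialB_coPotentialPow {p' : ℝ} (hp' : p' ≠ 0)
    (μ : FiniteMeasure T.Boundary) (α : T.Edge) :
    ∫⁻ ζ in T.tentBoundary α, T.potentialB (T.coPotentialPow p' μ) ζ ∂(μ : Measure T.Boundary) =
      T.coPotential μ α * T.potentialV (T.coPotentialPow p' μ) α.e + energyBeyond p' μ α := by
  simp only [setLIntegral_tentBoundary_potentialB, coPotentialPow_mul_measure_tentBoundary hp',
    energyBeyond, coe_coPotential]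

theorem normPow_coPotentialPow {p p' : ℝ} (h : p.HolderConjugate p')
    (μ : FiniteMeasure T.Boundary) : T.normPow p (T.coPotentialPow p' μ) = energy p' μ := by
  refine tsum_congr fun α => ?_
  rw [coPotentialPow, ← ENNReal.coe_rpow_of_nonneg _ h.nonneg, ← NNReal.rpow_mul,
    h.symm.sub_one_mul_conj]

theorem lintegral_potentialB_le_normPow_add_energy {p p' : ℝ} (h : p.HolderConjugate p')
    (f : T.Edge → ℝ≥0) (μ : FiniteMeasure T.Boundary) :
    ∫⁻ ζ, T.potentialB f ζ ∂(μ : Measure T.Boundary) ≤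
      T.normPow p f / ENNReal.ofReal p + energy p' μ / ENNReal.ofReal p' := calc
  ∫⁻ ζ, T.potentialB f ζ ∂(μ : Measure T.Boundary)
      = ∑' α, (f α : ℝ≥0∞) * T.coPotential μ α := by
        simp only [lintegral_potentialB, coe_coPotential]
    _ ≤ ∑' α, ((f α : ℝ≥0∞) ^ p / ENNReal.ofReal p +
          (T.coPotential μ α : ℝ≥0∞) ^ p' / ENNReal.ofReal p') :=
        ENNReal.tsum_le_tsum fun α => ENNReal.young_inequality _ _ h
    _ = T.normPow p f / ENNReal.ofReal p + energy p' μ / ENNReal.ofReal p' := by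
        simp only [ENNReal.tsum_add, div_eq_mul_inv, ENNReal.tsum_mul_right, normPow, energy,
          ENNReal.coe_rpow_of_nonneg _ h.symm.nonneg]

theorem measure_univ_le_capacity {p p' : ℝ} (h : p.HolderConjugate p')
    {μ : FiniteMeasure T.Boundary} (hμ : energy p' μ ≤ (μ : Measure T.Boundary) Set.univ)
    {E : Set T.Boundary} (hE : ∀ᵐ ζ ∂(μ : Measure T.Boundary), ζ ∈ E) :
    (μ : Measure T.Boundary) Set.univ ≤ T.capacity p E := by
  refine le_iInf₂ fun f hf => ?_
  set m := (μ : Measure T.Boundary) Set.univ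
  have hp : ENNReal.ofReal p ≠ 0 := ENNReal.ofReal_ne_zero_iff.2 h.pos
  have hp' : ENNReal.ofReal p' ≠ 0 := ENNReal.ofReal_ne_zero_iff.2 h.symm.pos
  have hsplit : m / ENNReal.ofReal p + m / ENNReal.ofReal p' = m := by
    rw [div_eq_mul_inv, div_eq_mul_inv, ← mul_add, h.inv_add_inv_ennreal, mul_one]
  have hyoung : m / ENNReal.ofReal p + m / ENNReal.ofReal p' ≤
      T.normPow p f / ENNReal.ofReal p + m / ENNReal.ofReal p' := calc
    m / ENNReal.ofReal p + m / ENNReal.ofReal p'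
      = ∫⁻ _, 1 ∂(μ : Measure T.Boundary) := by rw [hsplit, lintegral_one]
    _ ≤ ∫⁻ ζ, T.potentialB f ζ ∂(μ : Measure T.Boundary) := lintegral_mono_ae (hE.mono hf.2)
    _ ≤ T.normPow p f / ENNReal.ofReal p + energy p' μ / ENNReal.ofReal p' :=
        lintegral_potentialB_le_normPow_add_energy h f μ
    _ ≤ T.normPow p f / ENNReal.ofReal p + m / ENNReal.ofReal p' := by gcongr
  have hdiv : m / ENNReal.ofReal p ≤ T.normPow p f / ENNReal.ofReal p :=
    (ENNReal.add_le_add_iff_right (ENNReal.div_ne_top (measure_ne_top _ _) hp')).1 hyoung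
  rwa [ENNReal.div_le_iff hp ENNReal.ofReal_ne_top,
    ENNReal.div_mul_cancel hp ENNReal.ofReal_ne_top] at hdiv

theorem IsEquilibriumMeasure.energy_eq_measure_univ {p p' : ℝ} (h : p.HolderConjugate p')
    {μ : FiniteMeasure T.Boundary} {E : Set T.Boundary} (hE : T.IsEquilibriumMeasure p p' E μ) :
    energy p' μ = (μ : Measure T.Boundary) Set.univ := by
  obtain ⟨hsupp, hfun, hmass⟩ := hE
  rw [← normPow_coPotentialPow h, hfun.2, ← hmass, measure_of_measure_compl_eq_zero hsupp]

theorem isEquilibriumMeasure_of_potentialB_ae_eq_one {p p' : ℝ} (h : p.HolderConjugate p')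
    {μ : FiniteMeasure T.Boundary}
    (hμ : T.potentialB (T.coPotentialPow p' μ) =ᵐ[(μ : Measure T.Boundary)] 1) :
    T.IsEquilibriumMeasure p p' {ζ | T.potentialB (T.coPotentialPow p' μ) ζ = 1} μ := by
  set E := {ζ | T.potentialB (T.coPotentialPow p' μ) ζ = 1}
  have henergy : energy p' μ = (μ : Measure T.Boundary) Set.univ := by
    rw [← lintegral_potentialB_coPotentialPow h.symm.ne_zero, lintegral_congr_ae hμ]
    exact lintegral_one
  have hnorm : T.normPow p (T.coPotentialPow p' μ) = (μ : Measure T.Boundary) Set.univ :=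
    (normPow_coPotentialPow h μ).trans henergy
  have hΩ : T.coPotentialPow p' μ ∈ T.Omega p E :=
    ⟨hnorm ▸ measure_lt_top _ _, fun ζ (hζ : _ = _) => hζ.ge⟩
  have hcap : (μ : Measure T.Boundary) Set.univ = T.capacity p E :=
    le_antisymm (measure_univ_le_capacity h henergy.le hμ) ((iInf₂_le _ hΩ).trans hnorm.le)
  have hsupp : (μ : Measure T.Boundary) (closure E)ᶜ = 0 :=
    measure_mono_null (Set.compl_subset_compl.2 subset_closure) hμ
  have hclosure : T.coPotentialPow p' μ ∈ T.OmegaClosure p E := fun ε hε =>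
    ⟨_, hΩ, by simpa [normPow, h.pos] using hε⟩
  exact ⟨hsupp, ⟨hclosure, hnorm.trans hcap⟩, (measure_of_measure_compl_eq_zero hsupp).trans hcap⟩

theorem potentialB_ae_eq_one_iff_energy_eq_measure_univ {p' : ℝ} (hp' : p' ≠ 0)
    {μ : FiniteMeasure T.Boundary}
    (hμ : ∀ x : V, T.potentialV (T.coPotentialPow p' μ) x ≤ 1) :
    T.potentialB (T.coPotentialPow p' μ) =ᵐ[(μ : Measure T.Boundary)] 1 ↔
      energy p' μ = (μ : Measure T.Boundary) Set.univ := by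
  have hle : T.potentialB (T.coPotentialPow p' μ) ≤ᵐ[(μ : Measure T.Boundary)] 1 :=
    Filter.Eventually.of_forall (potentialB_le_of_potentialV_le hμ)
  have hone : ∫⁻ ζ, (1 : T.Boundary → ℝ≥0∞) ζ ∂(μ : Measure T.Boundary) =
      (μ : Measure T.Boundary) Set.univ := lintegral_one
  rw [ae_eq_iff_lintegral_eq hle aemeasurable_const (hone ▸ measure_ne_top _ _),
    lintegral_potentialB_coPotentialPow hp', hone]

theorem exists_isEquilibriumMeasure_iff_energy_eq_measure_univ {p p' : ℝ}
    (h : p.HolderConjugate p') {μ : FiniteMeasure T.Boundary}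
    (hμ : ∀ x : V, T.potentialV (T.coPotentialPow p' μ) x ≤ 1) :
    (∃ E : Set T.Boundary, T.IsEquilibriumMeasure p p' E μ) ↔
      energy p' μ = (μ : Measure T.Boundary) Set.univ :=
  ⟨fun ⟨_, hE⟩ => hE.energy_eq_measure_univ h, fun henergy =>
    ⟨_, isEquilibriumMeasure_of_potentialB_ae_eq_one h
      ((potentialB_ae_eq_one_iff_energy_eq_measure_univ h.symm.ne_zero hμ).2 henergy)⟩⟩

theorem energy_eq_measure_univ_iff_energyBeyond_eq {p' : ℝ} (hp' : p' ≠ 0)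
    {μ : FiniteMeasure T.Boundary}
    (hμ : ∀ x : V, T.potentialV (T.coPotentialPow p' μ) x ≤ 1) :
    energy p' μ = (μ : Measure T.Boundary) Set.univ ↔
      ∀ α : T.Edge, energyBeyond p' μ α =
        T.coPotential μ α * (1 - T.potentialV (T.coPotentialPow p' μ) α.e) := by
  have hsplit : ∀ α : T.Edge, T.coPotential μ α * T.potentialV (T.coPotentialPow p' μ) α.e +
      T.coPotential μ α * (1 - T.potentialV (T.coPotentialPow p' μ) α.e) =
        T.coPotential μ α := fun α => by
    rw [← mul_add, add_tsub_cancel_of_le (hμ _), mul_one]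
  constructor
  · intro henergy α
    have hae := (potentialB_ae_eq_one_iff_energy_eq_measure_univ hp' hμ).2 henergy
    have htent := setLIntegral_tentBoundary_potentialB_coPotentialPow hp' μ α
    rw [lintegral_congr_ae (ae_restrict_of_ae hae), Pi.one_def, setLIntegral_one,
      ← coe_coPotential] at htent
    have hfin : T.coPotential μ α * T.potentialV (T.coPotentialPow p' μ) α.e ≠ ∞ :=
      ENNReal.mul_ne_top ENNReal.coe_ne_top (potentialV_ne_top _ _)
    exact ((ENNReal.add_right_inj hfin).1 ((hsplit α).trans htent)).symm
  · intro hbeyond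
    obtain ⟨ω, hω⟩ := T.exists_rootEdge
    have htent := setLIntegral_tentBoundary_potentialB_coPotentialPow hp' μ ω
    rwa [hbeyond, hsplit, coe_coPotential, tentBoundary_eq_univ hω, Measure.restrict_univ,
      lintegral_potentialB_coPotentialPow hp'] at htent

end Energy

section Rescaling

open MeasureTheory

variable {V : Type*} {T : RootEdgeTree V}

theorem prod_predV_div {G₀ : Type*} [CommGroupWithZero G₀] {F : V → G₀} (hF : ∀ x, F x ≠ 0)
    (x : V) : ∏ γ ∈ (T.predV_finite x).toFinset, F γ.e / F γ.b = F x / F T.root := by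
  classical
  induction x using T.vertex_induction with
  | root => simp only [predV_root, Set.Finite.toFinset_empty, Finset.prod_empty, div_self (hF _)]
  | step α ih =>
    rw [toFinset_predV_e, Finset.prod_insert (by simpa using notMem_predV_b α), ih,
      div_mul_div_cancel₀ (hF _)]

theorem prod_Ico_div {G₀ : Type*} [CommGroupWithZero G₀] {F : V → G₀} (hF : ∀ x, F x ≠ 0)
    {α β : T.Edge} (h : T.le α β) :
    ∏ γ ∈ (T.Ico_finite α β).toFinset, F γ.e / F γ.b = F β.b / F α.b := by
  have hprod := prod_predV_div (T := T) hF β.b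
  rw [← toFinset_predV_b_disjUnion_toFinset_Ico h, Finset.prod_disjUnion, prod_predV_div hF]
    at hprod
  rw [← div_div_div_cancel_right₀ (hF T.root), ← hprod,
    mul_div_cancel_left₀ _ (div_ne_zero (hF _) (hF _))]

/-- The amount `1 - IM_p(x)` by which the potential of `M_p` falls short of `1` at a vertex, as a
real number; it is negative where `IM_p > 1`. -/
noncomputable def potentialGap (p' : ℝ) (μ : FiniteMeasure T.Boundary) (x : V) : ℝ :=
  1 - (T.potentialV (T.coPotentialPow p' μ) x).toReal

theorem potentialGap_pos {p' : ℝ} {μ : FiniteMeasure T.Boundary} {x : V}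
    (hx : T.potentialV (T.coPotentialPow p' μ) x < 1) : 0 < potentialGap p' μ x :=
  sub_pos.2 (ENNReal.toReal_lt_of_lt_ofReal (by rwa [ENNReal.ofReal_one]))

theorem potentialGap_e (p' : ℝ) (μ : FiniteMeasure T.Boundary) (γ : T.Edge) :
    potentialGap p' μ γ.e = potentialGap p' μ γ.b - (T.coPotential μ γ : ℝ) ^ (p' - 1) := by
  rw [potentialGap, potentialGap, potentialV_e,
    ENNReal.toReal_add ENNReal.coe_ne_top (potentialV_ne_top _ _), ENNReal.coe_toReal,
    coPotentialPow, NNReal.coe_rpow]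
  ring

theorem rescaled_eq_div_potentialGap (p p' : ℝ) (μ : FiniteMeasure T.Boundary) (γ : T.Edge) :
    T.rescaled p p' μ γ = (T.coPotential μ γ : ℝ) / potentialGap p' μ γ.b ^ (p / p') :=
  rfl

theorem rescaled_rpow {p p' : ℝ} {μ : FiniteMeasure T.Boundary} {γ : T.Edge}
    (hγ : 0 ≤ potentialGap p' μ γ.b) (r : ℝ) :
    T.rescaled p p' μ γ ^ r =
      (T.coPotential μ γ : ℝ) ^ r / potentialGap p' μ γ.b ^ (p / p' * r) := by
  rw [rescaled_eq_div_potentialGap,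
    Real.div_rpow (NNReal.coe_nonneg _) (Real.rpow_nonneg hγ _), ← Real.rpow_mul hγ]

theorem one_sub_rescaled_rpow {p p' : ℝ} (h : p.HolderConjugate p')
    {μ : FiniteMeasure T.Boundary} {γ : T.Edge} (hγ : 0 < potentialGap p' μ γ.b) :
    1 - T.rescaled p p' μ γ ^ (p' - 1) = potentialGap p' μ γ.e / potentialGap p' μ γ.b := by
  have hexp : p / p' * (p' - 1) = 1 := by
    rw [← h.symm.div_conj_eq_sub_one, div_mul_div_cancel₀ h.symm.ne_zero, div_self h.ne_zero]
  rw [rescaled_rpow hγ.le, hexp, Real.rpow_one, potentialGap_e, sub_div, div_self hγ.ne']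

theorem rescaled_mul_one_sub_rescaled_rpow {p p' : ℝ} (h : p.HolderConjugate p')
    {μ : FiniteMeasure T.Boundary} {α : T.Edge} (hα : 0 < potentialGap p' μ α.b) :
    T.rescaled p p' μ α * (1 - T.rescaled p p' μ α ^ (p' - 1)) =
      T.coPotential μ α * potentialGap p' μ α.e / potentialGap p' μ α.b ^ p := by
  rw [one_sub_rescaled_rpow h hα, rescaled_eq_div_potentialGap, div_mul_div_comm,
    ← Real.rpow_add_one hα.ne', h.div_conj_eq_sub_one, sub_add_cancel]

theorem rescaled_rpow_mul_prod_Ico {p p' : ℝ} (h : p.HolderConjugate p')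
    {μ : FiniteMeasure T.Boundary} (hμ : ∀ x : V, 0 < potentialGap p' μ x) {α β : T.Edge}
    (hαβ : T.le α β) :
    T.rescaled p p' μ β ^ p' *
        ∏ γ ∈ (T.Ico_finite α β).toFinset, (1 - T.rescaled p p' μ γ ^ (p' - 1)) ^ p =
      ((T.coPotential μ β ^ p' : ℝ≥0) : ℝ) / potentialGap p' μ α.b ^ p := by
  have hprod : ∏ γ ∈ (T.Ico_finite α β).toFinset, (1 - T.rescaled p p' μ γ ^ (p' - 1)) ^ p =
      potentialGap p' μ β.b ^ p / potentialGap p' μ α.b ^ p := by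
    simp only [one_sub_rescaled_rpow h (hμ _)]
    rw [Real.finsetProd_rpow _ _ fun γ _ => (div_pos (hμ _) (hμ _)).le,
      prod_Ico_div (fun x => (hμ x).ne') hαβ, Real.div_rpow (hμ _).le (hμ _).le]
  rw [hprod, rescaled_rpow (hμ _).le, div_mul_cancel₀ _ h.symm.ne_zero, NNReal.coe_rpow,
    div_mul_div_cancel₀ (Real.rpow_pos_of_pos (hμ _) _).ne']

theorem hasSum_rescaled_iff_energyBeyond_eq {p p' : ℝ} (h : p.HolderConjugate p')
    {μ : FiniteMeasure T.Boundary}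
    (hμ : ∀ x : V, T.potentialV (T.coPotentialPow p' μ) x < 1) (α : T.Edge) :
    HasSum
        (fun β : {β : T.Edge // T.lt α β} =>
          T.rescaled p p' μ β ^ p' *
            ∏ γ ∈ (T.Ico_finite α β).toFinset, (1 - T.rescaled p p' μ γ ^ (p' - 1)) ^ p)
        (T.rescaled p p' μ α * (1 - T.rescaled p p' μ α ^ (p' - 1))) ↔
      energyBeyond p' μ α =
        T.coPotential μ α * (1 - T.potentialV (T.coPotentialPow p' μ) α.e) := by
  have hgap : ∀ x, 0 < potentialGap p' μ x := fun x => potentialGap_pos (hμ x)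
  have htoReal : (T.coPotential μ α : ℝ) * potentialGap p' μ α.e = ((T.coPotential μ α : ℝ≥0∞) *
      (1 - T.potentialV (T.coPotentialPow p' μ) α.e)).toReal := by
    rw [ENNReal.toReal_mul, ENNReal.coe_toReal, ENNReal.toReal_sub_of_le (hμ _).le
      ENNReal.one_ne_top, ENNReal.toReal_one, potentialGap]
  rw [funext fun β : {β // T.lt α β} => rescaled_rpow_mul_prod_Ico h hgap β.2.1,
    rescaled_mul_one_sub_rescaled_rpow h (hgap _),
    hasSum_div_const_iff (Real.rpow_pos_of_pos (hgap _) _).ne', htoReal]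
  exact hasSum_coe_toReal_iff_tsum_eq (ENNReal.mul_ne_top ENNReal.coe_ne_top
    (ENNReal.sub_ne_top ENNReal.one_ne_top))

end Rescaling

end RootEdgeTree

theorem mainTheorem6 {V : Type*} (T : RootEdgeTree V) (p p' : ℝ) (hp : 1 < p)
    (hpp' : 1 / p + 1 / p' = 1)
    (μ : MeasureTheory.FiniteMeasure T.Boundary)
    (hμ : ∀ x : V, T.potentialV (T.coPotentialPow p' μ) x < 1) :
    (∃ E : Set T.Boundary, T.IsEquilibriumMeasure p p' E μ) ↔
      ∀ α : T.Edge,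
        HasSum
          (fun β : {β : T.Edge // T.lt α β} =>
            T.rescaled p p' μ β ^ p' *
              ∏ γ ∈ (T.Ico_finite α β).toFinset, (1 - T.rescaled p p' μ γ ^ (p' - 1)) ^ p)
          (T.rescaled p p' μ α * (1 - T.rescaled p p' μ α ^ (p' - 1))) := by
  have h : p.HolderConjugate p' :=
    Real.holderConjugate_iff.2 ⟨hp, by simpa only [one_div] using hpp'⟩
  have hle : ∀ x : V, T.potentialV (T.coPotentialPow p' μ) x ≤ 1 := fun x => (hμ x).le
  rw [RootEdgeTree.exists_isEquilibriumMeasure_iff_energy_eq_measure_univ h hle,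
    RootEdgeTree.energy_eq_measure_univ_iff_energyBeyond_eq h.symm.ne_zero hle]
  exact forall_congr' fun α =>
    (RootEdgeTree.hasSum_rescaled_iff_energyBeyond_eq h hμ α).symm
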